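/- Let $d\ge 0$ be an integer and $F(t)=\sum_{n\ge 0}f_nt^n=1+t+\cdots+t^d$ (so $f_n=1$ for $0\le n\le d$ and $f_n=0$ for all other integers $n$). There is exactly one family of integers $(s_\lambda^F)_\lambda$, indexed by all partitions $\lambda$, such that $$\prod_{i\ge 1}F(x_i)=\sum_\lambda s_\lambda^F\, s_\lambda(x_1,x_2,\ldots),$$ where $s_\lambda(x)$ are the Schur functions. For every partition $\lambda$, $$s_\lambda^F=\det\big(f_{\lambda_i-i+j}\big)_{1\le i,j\le \ell(\lambda)}\in\{1,-1,0\}.$$ More precisely, let $\lambda'$ be the conjugate partition, $\delta_d=(d-1,d-2,\ldots,1,0)$, and, for $0\le r\le d$, $\delta_{d+1}\setminus r=(d,d-1,\ldots,r+1,r-1,\ldots,1,0)$. If $\lambda'$ has at most $d$ parts and, for some $0\le r\le d$ and some permutation $\sigma\in S_d$, the vector $\lambda'+\delta_d=(\lambda'_1+d-1,\lambda'_2+d-2,\ldots,\lambda'_d)$ is congruent modulo $d+1$, entry by entry, to the vector obtained from $\delta_{d+1}\setminus r$ by permuting its entries by $\sigma$, then $$s_\lambda^F=(-1)^{|\lambda|+d+r}\,\mathrm{sign}(\sigma)$$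 (for every such pair $(r,\sigma)$). Otherwise $s_\lambda^F=0$. -/

import Mathlib

/-! Partitions are Young diagrams `μ` in English notation: with zero-based indices, the part
`λ_{i+1}` is `μ.rowLen i`, the part `λ'_{j+1}` of the conjugate partition is
`μ.transpose.rowLen j`, the length `ℓ(λ)` is `μ.colLen 0`, and `|λ|` is `μ.card`. -/

namespace TruncatedSchur

section

open scoped MvPowerSeries.WithPiTopology

/-- The content of a semistandard tableau `T`: the exponent vector of the monomial `x^T`, in which
the exponent of `x_k` is the number of cells of `T` with entry `k`. -/
noncomputable def content {μ : YoungDiagram} (T : SemistandardYoungTableau μ) : ℕ →₀ ℕ :=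
  ∑ c ∈ μ.cells, Finsupp.single (T c.1 c.2) 1

/-- The Schur function `s_μ` in the variables `x_0, x_1, x_2, …`, as a formal power series: the
coefficient of `x^m` is the (finite) number of semistandard tableaux of shape `μ`
and content `m`. -/
noncomputable def schur (μ : YoungDiagram) : MvPowerSeries ℕ ℤ :=
  fun m => (Nat.card {T : SemistandardYoungTableau μ // content T = m} : ℤ)

/-- `c` is a family of coefficients of `∏_i F(x_i)` with respect to the Schur functions:
`∏_i F(x_i) = ∑_μ c_μ s_μ`, where the infinite product and the infinite sum converge in the
topology of coefficientwise convergence of formal power series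
(the integers carry the discrete topology). -/
def IsSchurExpansion (F : Polynomial ℤ) (c : YoungDiagram → ℤ) : Prop :=
  ∃ P : MvPowerSeries ℕ ℤ,
    HasProd (fun i : ℕ => Polynomial.aeval (MvPowerSeries.X i : MvPowerSeries ℕ ℤ) F) P ∧
    HasSum (fun μ : YoungDiagram => c μ • schur μ) P

end

/-- `F(t) = 1 + t + ⋯ + t^d`. -/
noncomputable def truncF (d : ℕ) : Polynomial ℤ :=
  ∑ i ∈ Finset.range (d + 1), Polynomial.X ^ i

/-- The coefficient `f_k` of `F`, for an integer `k`; it is zero for negative `k`. -/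
noncomputable def coeffInt (F : Polynomial ℤ) (k : ℤ) : ℤ :=
  if 0 ≤ k then F.coeff k.toNat else 0

/-- The matrix `(f_{λ_i - i + j})_{1 ≤ i, j ≤ ℓ(λ)}`. -/
noncomputable def jacobiTrudi (F : Polynomial ℤ) (μ : YoungDiagram) :
    Matrix (Fin (μ.colLen 0)) (Fin (μ.colLen 0)) ℤ :=
  Matrix.of fun i j => coeffInt F ((μ.rowLen i : ℤ) - (i : ℤ) + (j : ℤ))

/-- The staircase `δ_n = (n - 1, n - 2, …, 1, 0)`. -/
def delta (n : ℕ) (i : Fin n) : ℕ := (i.rev : ℕ)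

/-- `δ_{d+1} ∖ r = (d, d - 1, …, r + 1, r - 1, …, 1, 0)`: the entry `r` of `δ_{d+1}`, which stands
at position `r.rev`, is skipped. -/
def deltaRemove (d : ℕ) (r : Fin (d + 1)) (i : Fin d) : ℕ :=
  delta (d + 1) (r.rev.succAbove i)

/-- `λ' + δ_d = σ(δ_{d+1} ∖ r)` in `ℤ/(d+1)ℤ`. For `λ' + δ_d` to be a vector with `d` entries, the
conjugate partition `λ'` must have at most `d` parts; the number of parts of `λ'` is the
number of columns of `λ`. -/
def Matches (d : ℕ) (μ : YoungDiagram) (r : Fin (d + 1)) (σ : Equiv.Perm (Fin d)) : Prop :=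
  μ.transpose.colLen 0 ≤ d ∧
    ∀ i : Fin d, ((μ.transpose.rowLen i + delta d i : ℕ) : ZMod (d + 1)) =
      ((deltaRemove d r (σ i) : ℕ) : ZMod (d + 1))

end TruncatedSchur

/-!
The proof avoids the theory of symmetric functions: a family `c` of integers with `c_∅ = 1` is the
family of Schur coefficients of `∏_i F(x_i)`, where `F = ∑ f_k t^k` and `f_0 = 1`, as soon as it
satisfies the Pieri recursion `∑_ν c_ν = f_k c_μ` for all `μ` and `k`, where `ν` runs over the
diagrams for which `ν / μ` is a horizontal strip of size `k` (`SatisfiesPieri.isSchurExpansion`).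
Indeed, deleting the largest entry from semistandard tableaux is a sum over horizontal strips
(`card_tableaux_add_single`), so that the recursion removes the variables one at a time. Conversely,
the coefficients are determined by the power series, since the transition matrix from Schur
functions to monomials is triangular for the statistic `n(μ) = ∑ (i - 1) μ_i`
(`IsSchurExpansion.unique`).

It therefore suffices to verify the Pieri recursion for two families, which then have to agree.

* For the Jacobi-Trudi determinants, the parts of `ν` range over independent intervals, so the sum
  over `ν` is a single determinant by multilinearity, and row and column operations evaluate it
  (`sum_piFinset_det_shiftMatrix`).

* For `F = 1 + t + ⋯ + t^d`, let `e_x` be the unit vectors of the residues modulo `d + 1`, and let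
  `c_μ` be `(-1)^|μ|` times the determinant with a first row of ones, followed by the rows `e_x` for
  the entries `x` of `μ' + δ_d`. Each entry of `ν'` exceeds that of `μ'` by `0` or `1`, so the sum
  over `ν` amounts to replacing each row `e_x` by `e_x - t e_{x+1}`. This is the action of
  `1 - t C` with `C` the cyclic shift, for which the row of ones is an eigenvector with eigenvalue
  `1 - t`; as `det (1 - t C) = 1 - t^{d+1}`, the determinant is multiplied by
  `(1 - t^{d+1}) / (1 - t) = F(t)` (`det_bordered_sub`).

Expanding the latter determinant along the row of ones shows that it vanishes unless the residues
of `μ' + δ_d` are those of `δ_{d+1} ∖ r` in some order, and then leaves a single permutation matrix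
(`residueCoeff_of_matches`, `exists_matches_of_residueCoeff_ne_zero`).
-/

namespace TruncatedSchur

open Finset

/-! ### Young diagrams and horizontal strips -/

/-- A diagram with `n` cells is contained in the square `n × n`. -/
theorem finite_card_eq (n : ℕ) : {μ : YoungDiagram | μ.card = n}.Finite := by
  refine Set.Finite.of_finite_image (f := YoungDiagram.cells)
    (Set.Finite.subset (Finset.finite_toSet (range n ×ˢ range n).powerset) ?_)
    (fun μ _ ν _ h => YoungDiagram.ext h)
  rintro _ ⟨μ, hμ, rfl⟩
  simp only [Set.mem_ofPred_eq] at hμ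
  simp only [mem_coe, mem_powerset]
  rintro ⟨i, j⟩ hij
  have hij' : (i, j) ∈ μ := hij
  rw [mem_product, mem_range, mem_range, ← hμ]
  constructor
  · have : (range (i + 1)).image (fun a => (a, j)) ⊆ μ.cells := by
      intro c hc
      obtain ⟨a, ha, rfl⟩ := mem_image.1 hc
      exact μ.up_left_mem (Nat.lt_succ_iff.1 (mem_range.1 ha)) le_rfl hij'
    have h := card_le_card this
    rw [card_image_of_injective _ (fun a b h => (Prod.ext_iff.1 h).1), card_range] at h
    exact h
  · have : (range (j + 1)).image (fun a => (i, a)) ⊆ μ.cells := by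
      intro c hc
      obtain ⟨a, ha, rfl⟩ := mem_image.1 hc
      exact μ.up_left_mem le_rfl (Nat.lt_succ_iff.1 (mem_range.1 ha)) hij'
    have h := card_le_card this
    rw [card_image_of_injective _ (fun a b h => (Prod.ext_iff.1 h).2), card_range] at h
    exact h

/-- The finite set of Young diagrams with `n` cells. -/
noncomputable def diagrams (n : ℕ) : Finset YoungDiagram := (finite_card_eq n).toFinset

@[simp]
theorem mem_diagrams {n : ℕ} {μ : YoungDiagram} : μ ∈ diagrams n ↔ μ.card = n := by
  simp [diagrams]

/-- `ν / μ` is a horizontal strip: `μ` is contained in `ν`, and no two cells of `ν` outside `μ` lie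
in the same column. -/
def IsHorizontalStrip (μ ν : YoungDiagram) : Prop :=
  μ ≤ ν ∧ ∀ i j, (i + 1, j) ∈ ν → (i, j) ∈ μ

theorem isHorizontalStrip_iff_rowLen {μ ν : YoungDiagram} :
    IsHorizontalStrip μ ν ↔ ∀ i, μ.rowLen i ≤ ν.rowLen i ∧ ν.rowLen (i + 1) ≤ μ.rowLen i := by
  constructor
  · rintro ⟨h1, h2⟩ i
    constructor
    · by_contra! h
      have := h1 (YoungDiagram.mem_iff_lt_rowLen.2 h)
      exact lt_irrefl _ (YoungDiagram.mem_iff_lt_rowLen.1 this)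
    · by_contra! h
      have := h2 i _ (YoungDiagram.mem_iff_lt_rowLen.2 h)
      exact lt_irrefl _ (YoungDiagram.mem_iff_lt_rowLen.1 this)
  · intro h
    refine ⟨?_, ?_⟩
    · rintro ⟨i, j⟩ hij
      exact YoungDiagram.mem_iff_lt_rowLen.2
        ((YoungDiagram.mem_iff_lt_rowLen.1 hij).trans_le (h i).1)
    · intro i j hij
      exact YoungDiagram.mem_iff_lt_rowLen.2
        ((YoungDiagram.mem_iff_lt_rowLen.1 hij).trans_le (h i).2)

theorem isHorizontalStrip_iff_colLen {μ ν : YoungDiagram} :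
    IsHorizontalStrip μ ν ↔ ∀ j, μ.colLen j ≤ ν.colLen j ∧ ν.colLen j ≤ μ.colLen j + 1 := by
  constructor
  · rintro ⟨h1, h2⟩ j
    constructor
    · by_contra! h
      have := h1 (YoungDiagram.mem_iff_lt_colLen.2 h)
      exact lt_irrefl _ (YoungDiagram.mem_iff_lt_colLen.1 this)
    · by_contra! h
      have := h2 _ _ (YoungDiagram.mem_iff_lt_colLen.2 h)
      exact lt_irrefl _ (YoungDiagram.mem_iff_lt_colLen.1 this)
  · intro h
    refine ⟨?_, ?_⟩
    · rintro ⟨i, j⟩ hij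
      exact YoungDiagram.mem_iff_lt_colLen.2
        ((YoungDiagram.mem_iff_lt_colLen.1 hij).trans_le (h j).1)
    · intro i j hij
      have h1 := YoungDiagram.mem_iff_lt_colLen.1 hij
      have h2 := (h j).2
      exact YoungDiagram.mem_iff_lt_colLen.2 (by omega)

theorem rowLen_eq_zero {n : ℕ} {μ : YoungDiagram} (h : μ.colLen 0 ≤ n) {i : ℕ} (hi : n ≤ i) :
    μ.rowLen i = 0 := by
  by_contra h0
  have := YoungDiagram.mem_iff_lt_colLen.1
    (YoungDiagram.mem_iff_lt_rowLen.2 (Nat.pos_of_ne_zero h0))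
  omega

theorem ext_rowLen {μ ν : YoungDiagram} (h : ∀ i, μ.rowLen i = ν.rowLen i) : μ = ν := by
  ext ⟨i, j⟩
  simp [YoungDiagram.mem_iff_lt_rowLen, h]

theorem card_eq_sum_rowLen {n : ℕ} {μ : YoungDiagram} (h : μ.colLen 0 ≤ n) :
    μ.card = ∑ i : Fin n, μ.rowLen i := by
  rw [Fin.sum_univ_eq_sum_range μ.rowLen, YoungDiagram.card,
    card_eq_sum_card_fiberwise (s := μ.cells) (t := range n) (f := Prod.fst)]
  · exact sum_congr rfl fun i _ => μ.rowLen_eq_card.symm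
  · rintro ⟨i, j⟩ hc
    rw [mem_coe, mem_range]
    have h1 : (i, 0) ∈ μ := μ.up_left_mem le_rfl (Nat.zero_le j) hc
    exact (YoungDiagram.mem_iff_lt_colLen.1 h1).trans_le h

theorem card_transpose (μ : YoungDiagram) : μ.transpose.card = μ.card := by
  simp [YoungDiagram.card, YoungDiagram.transpose]

theorem exists_diagram_of_antitone {n : ℕ} (b : Fin n → ℕ) (hb : Antitone b) :
    ∃ μ : YoungDiagram, μ.colLen 0 ≤ n ∧ ∀ i : Fin n, μ.rowLen i = b i := by
  let μ : YoungDiagram :=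
    { cells := (univ : Finset (Fin n)).biUnion fun i => (range (b i)).image fun j => ((i : ℕ), j)
      isLowerSet := by
        rintro ⟨i, j⟩ ⟨i', j'⟩ ⟨h1, h2⟩ h
        simp only [coe_biUnion, mem_coe, mem_univ, Set.iUnion_true, Set.mem_iUnion, mem_image,
          mem_range, Prod.mk.injEq] at h ⊢
        obtain ⟨a, c, hc, rfl, rfl⟩ := h
        have h1' : i' ≤ (a : ℕ) := h1
        have h2' : j' ≤ c := h2
        exact ⟨⟨i', h1'.trans_lt a.2⟩, j', (h2'.trans_lt hc).trans_le (hb h1'), rfl, rfl⟩ }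
  have hmem : ∀ i j, (i, j) ∈ μ ↔ ∃ h : i < n, j < b ⟨i, h⟩ := by
    intro i j
    rw [← YoungDiagram.mem_cells]
    simp only [μ, mem_biUnion, mem_univ, true_and, mem_image, mem_range, Prod.mk.injEq]
    constructor
    · rintro ⟨a, c, hc, rfl, rfl⟩
      exact ⟨a.2, hc⟩
    · rintro ⟨h, hj⟩
      exact ⟨⟨i, h⟩, j, hj, rfl, rfl⟩
  refine ⟨μ, ?_, ?_⟩
  · by_contra! h
    obtain ⟨h', -⟩ := (hmem _ _).1 (YoungDiagram.mem_iff_lt_colLen.2 h)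
    exact lt_irrefl _ h'
  · intro i
    refine eq_of_forall_lt_iff fun j => ?_
    rw [← YoungDiagram.mem_iff_lt_rowLen, hmem]
    exact ⟨fun ⟨_, h⟩ => h, fun h => ⟨i.2, h⟩⟩

theorem rowLen_le_card (μ : YoungDiagram) (i : ℕ) : μ.rowLen i ≤ μ.card := by
  rw [YoungDiagram.rowLen_eq_card]
  exact card_le_card (filter_subset _ _)

/-! ### Tableaux and the branching rule -/

theorem degree_content {μ : YoungDiagram} (T : SemistandardYoungTableau μ) :
    (content T).degree = μ.card := by
  simp [content, map_sum]

theorem content_apply {μ : YoungDiagram} (T : SemistandardYoungTableau μ) (k : ℕ) :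
    content T k = #{c ∈ μ.cells | T c.1 c.2 = k} := by
  rw [content, Finsupp.finsetSum_apply, card_filter]
  exact sum_congr rfl fun c _ => Finsupp.single_apply

theorem mem_support_content {μ : YoungDiagram} (T : SemistandardYoungTableau μ) {i j : ℕ}
    (h : (i, j) ∈ μ) : T i j ∈ (content T).support := by
  rw [Finsupp.mem_support_iff, content_apply]
  exact card_ne_zero_of_mem (mem_filter.2 ⟨(YoungDiagram.mem_cells _).2 h, rfl⟩)

theorem finite_content_eq (μ : YoungDiagram) (m : ℕ →₀ ℕ) :
    {T : SemistandardYoungTableau μ | content T = m}.Finite := by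
  have hlt : ∀ T : {T : SemistandardYoungTableau μ | content T = m}, ∀ c : μ.cells,
      T.1 c.1.1 c.1.2 < m.support.sup id + 1 := by
    rintro ⟨T, rfl⟩ c
    exact Nat.lt_succ_of_le (le_sup (f := id) (mem_support_content T c.2))
  refine Set.finite_coe_iff.1 (Finite.of_injective
    (fun T (c : μ.cells) => (⟨T.1 c.1.1 c.1.2, hlt T c⟩ : Fin (m.support.sup id + 1))) ?_)
  intro T S h
  refine Subtype.ext (SemistandardYoungTableau.ext fun i j => ?_)
  by_cases hc : (i, j) ∈ μ
  · exact congrArg Fin.val (congrFun h ⟨(i, j), hc⟩)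
  · rw [T.1.zeros hc, S.1.zeros hc]

/-- The finite set of semistandard tableaux of shape `μ` and content `m`. -/
noncomputable def tableaux (μ : YoungDiagram) (m : ℕ →₀ ℕ) : Finset (SemistandardYoungTableau μ) :=
  (finite_content_eq μ m).toFinset

@[simp]
theorem mem_tableaux {μ : YoungDiagram} {m : ℕ →₀ ℕ} {T : SemistandardYoungTableau μ} :
    T ∈ tableaux μ m ↔ content T = m := by
  simp [tableaux]

theorem coeff_schur (μ : YoungDiagram) (m : ℕ →₀ ℕ) :
    MvPowerSeries.coeff m (schur μ) = #(tableaux μ m) := by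
  change ((Nat.card {T : SemistandardYoungTableau μ // content T = m} : ℕ) : ℤ) = _
  rw [tableaux, ← Set.ncard_eq_toFinset_card _ (finite_content_eq μ m), ← Nat.card_coe_set_eq]
  rfl

theorem tableaux_eq_empty {μ : YoungDiagram} {m : ℕ →₀ ℕ} (h : μ.card ≠ m.degree) :
    tableaux μ m = ∅ := by
  refine eq_empty_of_forall_notMem fun T hT => h ?_
  rw [← mem_tableaux.1 hT, degree_content]

/-- The cells of `T` with entries less than `N`. -/
def below {ν : YoungDiagram} (T : SemistandardYoungTableau ν) (N : ℕ) : YoungDiagram where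
  cells := {c ∈ ν.cells | T c.1 c.2 < N}
  isLowerSet := by
    rintro ⟨i, j⟩ ⟨i', j'⟩ ⟨h1, h2⟩ h
    have h1' : i' ≤ i := h1
    have h2' : j' ≤ j := h2
    simp only [coe_filter, Set.mem_ofPred_eq, YoungDiagram.mem_cells] at h ⊢
    refine ⟨ν.up_left_mem h1' h2' h.1, lt_of_le_of_lt ?_ h.2⟩
    exact (T.row_weak_of_le h2' (ν.up_left_mem h1' le_rfl h.1)).trans (T.col_weak h1' h.1)

theorem mem_below {ν : YoungDiagram} {T : SemistandardYoungTableau ν} {N i j : ℕ} :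
    (i, j) ∈ below T N ↔ (i, j) ∈ ν ∧ T i j < N := by
  rw [← YoungDiagram.mem_cells]
  simp [below]

/-- The restriction of a tableau to a smaller shape. -/
def restrict {ν : YoungDiagram} (T : SemistandardYoungTableau ν) {μ : YoungDiagram} (h : μ ≤ ν) :
    SemistandardYoungTableau μ where
  entry i j := if (i, j) ∈ μ then T i j else 0
  row_weak' := fun {i j1 j2} hj hc => by
    rw [if_pos hc, if_pos (μ.up_left_mem le_rfl hj.le hc)]
    exact T.row_weak hj (h hc)
  col_strict' := fun {i1 i2 j} hi hc => by
    rw [if_pos hc, if_pos (μ.up_left_mem hi.le le_rfl hc)]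
    exact T.col_strict hi (h hc)
  zeros' := fun hc => if_neg hc

theorem restrict_apply {μ ν : YoungDiagram} (T : SemistandardYoungTableau ν) (h : μ ≤ ν)
    (i j : ℕ) : restrict T h i j = if (i, j) ∈ μ then T i j else 0 := rfl

/-- The extension of a tableau with entries less than `N` by a horizontal strip filled with `N`. -/
def extend {μ ν : YoungDiagram} (h : IsHorizontalStrip μ ν) {N : ℕ}
    (T : SemistandardYoungTableau μ) (hT : ∀ i j, (i, j) ∈ μ → T i j < N) :
    SemistandardYoungTableau ν where
  entry i j := if (i, j) ∈ μ then T i j else if (i, j) ∈ ν then N else 0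
  row_weak' := fun {i j1 j2} hj hc => by
    by_cases h2 : (i, j2) ∈ μ
    · rw [if_pos h2, if_pos (μ.up_left_mem le_rfl hj.le h2)]
      exact T.row_weak hj h2
    · rw [if_neg h2, if_pos hc]
      split_ifs with h3 h4
      · exact (hT _ _ h3).le
      · exact le_rfl
      · exact Nat.zero_le _
  col_strict' := fun {i1 i2 j} hi hc => by
    obtain ⟨i, rfl⟩ : ∃ i, i2 = i + 1 := ⟨i2 - 1, by omega⟩
    have h1 : (i1, j) ∈ μ := μ.up_left_mem (Nat.lt_succ_iff.1 hi) le_rfl (h.2 _ _ hc)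
    rw [if_pos h1]
    split_ifs with h2
    · exact T.col_strict hi h2
    · exact hT _ _ h1
  zeros' := fun hc => by
    rw [if_neg (fun h' => hc (h.1 h')), if_neg hc]

theorem extend_apply {μ ν : YoungDiagram} (h : IsHorizontalStrip μ ν) {N : ℕ}
    (T : SemistandardYoungTableau μ) (hT : ∀ i j, (i, j) ∈ μ → T i j < N) (i j : ℕ) :
    extend h T hT i j = if (i, j) ∈ μ then T i j else if (i, j) ∈ ν then N else 0 := rfl

/-- If the cells of `ν` outside `μ` carry the entry `N`, they contribute `N` with multiplicity
`|ν| - |μ|` to the content. -/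
theorem content_eq_add_single {μ ν : YoungDiagram} (h : μ ≤ ν) {N : ℕ}
    (T : SemistandardYoungTableau ν) (S : SemistandardYoungTableau μ)
    (hS : ∀ i j, (i, j) ∈ μ → T i j = S i j)
    (hN : ∀ i j, (i, j) ∈ ν → (i, j) ∉ μ → T i j = N) :
    content T = content S + Finsupp.single N (ν.card - μ.card) := by
  have hsub : μ.cells ⊆ ν.cells := YoungDiagram.cells_subset_iff.2 h
  rw [content, ← sum_sdiff hsub, add_comm, content]
  congr 1
  · exact sum_congr rfl fun c hc => by rw [hS _ _ hc]
  · rw [sum_congr rfl (g := fun _ => Finsupp.single N 1), sum_const, card_sdiff_of_subset hsub,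
      Finsupp.smul_single, smul_eq_mul, mul_one]
    intro c hc
    rw [mem_sdiff] at hc
    rw [hN _ _ hc.1 hc.2]

theorem isHorizontalStrip_below {ν : YoungDiagram} {T : SemistandardYoungTableau ν} {N : ℕ}
    (hT : ∀ i j, (i, j) ∈ ν → T i j ≤ N) : IsHorizontalStrip (below T N) ν := by
  refine ⟨fun ⟨i, j⟩ hc => (mem_below.1 hc).1, fun i j hc => mem_below.2 ⟨?_, ?_⟩⟩
  · exact ν.up_left_mem (Nat.le_succ i) le_rfl hc
  · exact (T.col_strict (Nat.lt_succ_self i) hc).trans_le (hT _ _ hc)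

open Classical in
/-- Branching rule: removing the cells with the largest entry `N` from a tableau leaves a tableau
whose shape differs from the original one by a horizontal strip. -/
theorem card_tableaux_add_single (ν : YoungDiagram) {m : ℕ →₀ ℕ} {N k : ℕ}
    (hm : ∀ i ∈ m.support, i < N) (hν : ν.card = m.degree + k) :
    #(tableaux ν (m + Finsupp.single N k)) =
      ∑ μ ∈ diagrams m.degree with IsHorizontalStrip μ ν, #(tableaux μ m) := by
  have hmN : m N = 0 := by
    by_contra h
    exact lt_irrefl _ (hm N (Finsupp.mem_support_iff.2 h))
  have hle : ∀ T ∈ tableaux ν (m + Finsupp.single N k), ∀ i j, (i, j) ∈ ν → T i j ≤ N := by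
    intro T hT i j hc
    have := mem_support_content T hc
    rw [mem_tableaux.1 hT] at this
    rcases mem_union.1 (Finsupp.support_add this) with h | h
    · exact (hm _ h).le
    · exact (mem_singleton.1 (Finsupp.support_single_subset h)).le
  have hcont : ∀ T ∈ tableaux ν (m + Finsupp.single N k), ∀ (h : below T N ≤ ν),
      content (restrict T h) = m := by
    intro T hT h
    have h1 := content_eq_add_single h T (restrict T h) (N := N)
      (fun i j hc => by rw [restrict_apply, if_pos hc])
      (fun i j hc hc' => le_antisymm (hle T hT _ _ hc) (by
        by_contra! h'
        exact hc' (mem_below.2 ⟨hc, h'⟩)))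
    have h0 : content (restrict T h) N = 0 := by
      rw [content_apply, card_eq_zero, filter_eq_empty_iff]
      rintro ⟨i, j⟩ hc
      have hc' : (i, j) ∈ below T N := hc
      simp only [restrict_apply, if_pos hc']
      exact (mem_below.1 hc').2.ne
    rw [mem_tableaux.1 hT] at h1
    have h2 : k = ν.card - (below T N).card := by
      have := DFunLike.congr_fun h1 N
      simpa [hmN, h0] using this
    rw [← h2] at h1
    exact (add_right_cancel h1).symm
  rw [card_eq_sum_card_fiberwise (f := fun T => below T N)
    (t := {μ ∈ diagrams m.degree | IsHorizontalStrip μ ν})]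
  · refine sum_congr rfl fun μ hμ => ?_
    rw [mem_filter, mem_diagrams] at hμ
    obtain ⟨hμc, hμν⟩ := hμ
    have hlt : ∀ S ∈ tableaux μ m, ∀ i j, (i, j) ∈ μ → S i j < N := by
      intro S hS i j hc
      have := mem_support_content S hc
      rw [mem_tableaux.1 hS] at this
      exact hm _ this
    refine card_bij' (fun T _ => restrict T hμν.1) (fun S hS => extend hμν S (hlt S hS)) ?_ ?_ ?_ ?_
    · intro T hT
      rw [mem_filter] at hT
      obtain ⟨hT, rfl⟩ := hT
      exact mem_tableaux.2 (hcont T hT _)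
    · intro S hS
      refine mem_filter.2 ⟨mem_tableaux.2 ?_, ?_⟩
      · rw [content_eq_add_single hμν.1 _ S (N := N)
          (fun i j hc => by rw [extend_apply, if_pos hc])
          (fun i j hc hc' => by rw [extend_apply, if_neg hc', if_pos hc]),
          mem_tableaux.1 hS, hν, hμc, Nat.add_sub_cancel_left]
      · ext ⟨i, j⟩
        rw [YoungDiagram.mem_cells, YoungDiagram.mem_cells, mem_below, extend_apply]
        constructor
        · rintro ⟨h1, h2⟩
          by_contra h3
          rw [if_neg h3, if_pos h1] at h2
          exact lt_irrefl _ h2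
        · intro h
          rw [if_pos h]
          exact ⟨hμν.1 h, hlt S hS _ _ h⟩
    · intro T hT'
      obtain ⟨hT, rfl⟩ := mem_filter.1 hT'
      ext i j
      rw [extend_apply, restrict_apply]
      split_ifs with h1 h2
      · rfl
      · refine (le_antisymm (hle T hT _ _ h2) ?_).symm
        by_contra! h'
        exact h1 (mem_below.2 ⟨h2, h'⟩)
      · exact (T.zeros h2).symm
    · intro S hS
      ext i j
      rw [restrict_apply, extend_apply]
      split_ifs with h1
      · rfl
      · exact (S.zeros h1).symm
  · intro T hT
    have hs := isHorizontalStrip_below (hle T hT)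
    refine mem_coe.2 (mem_filter.2 ⟨mem_diagrams.2 ?_, hs⟩)
    rw [← hcont T hT hs.1, degree_content]

/-! ### The Pieri recursion characterizes Schur expansions -/

open Classical in
/-- The Pieri recursion for a family `c` of integers with respect to `F = ∑ f_k t^k`:
`∑_ν c_ν = f_k c_μ`, where `ν` runs over the diagrams such that `ν / μ` is a horizontal strip of
size `k`. -/
def SatisfiesPieri (F : Polynomial ℤ) (c : YoungDiagram → ℤ) : Prop :=
  ∀ (μ : YoungDiagram) (k : ℕ),
    ∑ ν ∈ diagrams (μ.card + k) with IsHorizontalStrip μ ν, c ν = F.coeff k * c μ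

theorem card_tableaux_bot : #(tableaux ⊥ 0) = 1 := by
  rw [card_eq_one]
  refine ⟨default, eq_singleton_iff_unique_mem.2 ⟨?_, fun T _ => ?_⟩⟩
  · rw [mem_tableaux]
    simp [content]
  · ext i j
    rw [T.zeros (YoungDiagram.notMem_bot _),
      SemistandardYoungTableau.zeros _ (YoungDiagram.notMem_bot _)]

open Classical in
/-- Under the Pieri recursion, the coefficients of `∑_ν c_ν s_ν` are those of `∏_i F(x_i)`: by the
branching rule, the variables can be removed one at a time, the largest first. -/
theorem SatisfiesPieri.sum_mul_card_tableaux {F : Polynomial ℤ} {c : YoungDiagram → ℤ}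
    (hc : SatisfiesPieri F c) (h1 : c ⊥ = 1) (N : ℕ) (m : ℕ →₀ ℕ) (hm : ∀ i ∈ m.support, i < N) :
    ∑ ν ∈ diagrams m.degree, c ν * (#(tableaux ν m) : ℤ) = ∏ i ∈ range N, F.coeff (m i) := by
  induction N generalizing m with
  | zero =>
    obtain rfl : m = 0 := by
      refine Finsupp.support_eq_empty.1 (eq_empty_of_forall_notMem fun i hi => ?_)
      exact absurd (hm i hi) (Nat.not_lt_zero i)
    have : diagrams 0 = {⊥} := by
      ext μ
      rw [mem_diagrams, mem_singleton, YoungDiagram.card, card_eq_zero]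
      exact ⟨fun h => YoungDiagram.ext h, fun h => by rw [h]; rfl⟩
    simp [this, h1, card_tableaux_bot]
  | succ N ih =>
    obtain ⟨m', k, rfl, hm'⟩ : ∃ (m' : ℕ →₀ ℕ) (k : ℕ), m = m' + Finsupp.single N k ∧
        ∀ i ∈ m'.support, i < N := by
      refine ⟨m.erase N, m N, (Finsupp.erase_add_single N m).symm, fun i hi => ?_⟩
      rw [Finsupp.support_erase, mem_erase] at hi
      have := hm i hi.2
      omega
    have hN : m' N = 0 := by
      by_contra h
      exact lt_irrefl _ (hm' N (Finsupp.mem_support_iff.2 h))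
    have hdeg : (m' + Finsupp.single N k).degree = m'.degree + k := by simp
    rw [hdeg]
    calc ∑ ν ∈ diagrams (m'.degree + k), c ν * (#(tableaux ν (m' + Finsupp.single N k)) : ℤ)
        = ∑ ν ∈ diagrams (m'.degree + k), ∑ μ ∈ diagrams m'.degree,
            if IsHorizontalStrip μ ν then c ν * (#(tableaux μ m') : ℤ) else 0 := by
          refine sum_congr rfl fun ν hν => ?_
          rw [card_tableaux_add_single ν hm' (mem_diagrams.1 hν), Nat.cast_sum, mul_sum, sum_filter]
      _ = ∑ μ ∈ diagrams m'.degree, F.coeff k * (c μ * (#(tableaux μ m') : ℤ)) := by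
          rw [sum_comm]
          refine sum_congr rfl fun μ hμ => ?_
          rw [← sum_filter, ← sum_mul, ← mem_diagrams.1 hμ, hc μ k, mul_assoc]
      _ = _ := by
          rw [← mul_sum, ih m' hm', prod_range_succ, mul_comm]
          congr 1
          · refine prod_congr rfl fun i hi => ?_
            rw [Finsupp.add_apply, Finsupp.single_eq_of_ne (mem_range.1 hi).ne, add_zero]
          · simp [hN]

theorem coeff_aeval_X (F : Polynomial ℤ) (a : ℕ) (n : ℕ →₀ ℕ) :
    MvPowerSeries.coeff n (Polynomial.aeval (MvPowerSeries.X a : MvPowerSeries ℕ ℤ) F) =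
      if n = Finsupp.single a (n a) then F.coeff (n a) else 0 := by
  rw [Polynomial.aeval_eq_sum_range, map_sum]
  simp only [MvPowerSeries.coeff_smul, MvPowerSeries.coeff_X_pow]
  have key : ∀ i, n = Finsupp.single a i ↔ (n = Finsupp.single a (n a) ∧ i = n a) := by
    intro i
    constructor
    · intro h
      have : n a = i := by rw [h]; simp
      rw [this]
      exact ⟨h, rfl⟩
    · rintro ⟨h, rfl⟩
      exact h
  split_ifs with h
  · by_cases hn : n a ≤ F.natDegree
    · rw [sum_eq_single (n a)]
      · rw [if_pos h, mul_one]
      · intro b _ hb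
        rw [if_neg (fun h' => hb ((key b).1 h').2), mul_zero]
      · intro h'
        exact absurd (mem_range.2 (Nat.lt_succ_of_le hn)) h'
    · rw [Polynomial.coeff_eq_zero_of_natDegree_lt (not_le.1 hn)]
      refine sum_eq_zero fun b hb => ?_
      rw [if_neg, mul_zero]
      intro h'
      have := mem_range.1 hb
      have := ((key b).1 h').2
      omega
  · refine sum_eq_zero fun b _ => ?_
    rw [if_neg (fun h' => h ((key b).1 h').1), mul_zero]

/-- In a finite product, the coefficient of `x^m` picks `f_{m_i}` from each factor `F(x_i)`. -/
theorem coeff_prod_aeval_X (F : Polynomial ℤ) (S : Finset ℕ) (m : ℕ →₀ ℕ) :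
    MvPowerSeries.coeff m
        (∏ i ∈ S, Polynomial.aeval (MvPowerSeries.X i : MvPowerSeries ℕ ℤ) F) =
      if m.support ⊆ S then ∏ i ∈ S, F.coeff (m i) else 0 := by
  induction S using Finset.induction_on generalizing m with
  | empty =>
    rw [prod_empty, prod_empty, MvPowerSeries.coeff_one]
    simp [subset_empty]
  | insert a S ha ih =>
    rw [prod_insert ha, MvPowerSeries.coeff_mul, sum_eq_single (Finsupp.single a (m a), m.erase a)]
    · simp only [coeff_aeval_X, ih, Finsupp.single_eq_same, if_true, Finsupp.support_erase]
      simp only [prod_insert ha, ← subset_insert_iff]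
      split_ifs with h
      · congr 1
        refine prod_congr rfl fun i hi => ?_
        rw [Finsupp.erase_ne (ne_of_mem_of_not_mem hi ha)]
      · rw [mul_zero]
    · rintro ⟨p, q⟩ hpq hne
      rw [HasAntidiagonal.mem_antidiagonal] at hpq
      simp only at hpq
      simp only [coeff_aeval_X, ih]
      by_cases hp : p = Finsupp.single a (p a)
      · rw [if_neg (c := q.support ⊆ S), mul_zero]
        intro hq
        have hqa : q a = 0 := by
          by_contra h
          exact ha (hq (Finsupp.mem_support_iff.2 h))
        refine hne (Prod.ext ?_ ?_)
        · simp only [← hpq, Finsupp.add_apply, hqa, add_zero]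
          exact hp
        · simp only [← hpq]
          rw [Finsupp.erase_add, hp, Finsupp.erase_single, zero_add,
            Finsupp.erase_of_notMem_support (by simpa using hqa)]
      · rw [if_neg hp, zero_mul]
    · intro h
      refine absurd (HasAntidiagonal.mem_antidiagonal.2 ?_) h
      exact Finsupp.single_add_erase a m

open scoped MvPowerSeries.WithPiTopology in
theorem hasProd_aeval_X {F : Polynomial ℤ} (hF : F.coeff 0 = 1) {P : MvPowerSeries ℕ ℤ}
    (hP : ∀ m, MvPowerSeries.coeff m P = ∏ i ∈ m.support, F.coeff (m i)) :
    HasProd (fun i : ℕ => Polynomial.aeval (MvPowerSeries.X i : MvPowerSeries ℕ ℤ) F) P := by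
  refine (MvPowerSeries.WithPiTopology.tendsto_iff_coeff_tendsto _ _ _).2 fun m => ?_
  refine tendsto_const_nhds.congr' ?_
  filter_upwards [Filter.eventually_ge_atTop m.support] with S hS
  rw [coeff_prod_aeval_X, if_pos hS, hP]
  refine prod_subset hS fun i _ hi => ?_
  rw [Finsupp.notMem_support_iff.1 hi, hF]

open scoped MvPowerSeries.WithPiTopology in
/-- Only the diagrams with `n` cells contribute to the coefficients of degree `n`, so convergence
of `∑_ν c_ν s_ν` to `P` amounts to an identity of finite sums for each monomial. -/
theorem hasSum_smul_schur_iff {c : YoungDiagram → ℤ} {P : MvPowerSeries ℕ ℤ} :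
    HasSum (fun μ => c μ • schur μ) P ↔
      ∀ m, MvPowerSeries.coeff m P =
        ∑ ν ∈ diagrams m.degree, c ν * (#(tableaux ν m) : ℤ) := by
  rw [MvPowerSeries.WithPiTopology.hasSum_iff_hasSum_coeff]
  refine forall_congr' fun m => ?_
  simp only [map_zsmul, coeff_schur, smul_eq_mul]
  have h : HasSum (fun ν => c ν * (#(tableaux ν m) : ℤ))
      (∑ ν ∈ diagrams m.degree, c ν * (#(tableaux ν m) : ℤ)) := by
    refine hasSum_sum_of_ne_finset_zero fun ν hν => ?_
    rw [tableaux_eq_empty (fun h => hν (mem_diagrams.2 h)), card_empty, Nat.cast_zero, mul_zero]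
  exact ⟨fun h' => h'.unique h, fun h' => h' ▸ h⟩

theorem SatisfiesPieri.isSchurExpansion {F : Polynomial ℤ} (hF : F.coeff 0 = 1)
    {c : YoungDiagram → ℤ} (hc : SatisfiesPieri F c) (h1 : c ⊥ = 1) : IsSchurExpansion F c := by
  let P : MvPowerSeries ℕ ℤ := fun m => ∏ i ∈ m.support, F.coeff (m i)
  have hP : ∀ m, MvPowerSeries.coeff m P = ∏ i ∈ m.support, F.coeff (m i) := fun m => rfl
  refine ⟨P, hasProd_aeval_X hF hP, hasSum_smul_schur_iff.2 fun m => ?_⟩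
  have hN : m.support ⊆ range (m.support.sup id + 1) := fun i hi =>
    mem_range.2 (Nat.lt_succ_of_le (le_sup (f := id) hi))
  rw [hP, hc.sum_mul_card_tableaux h1 _ m (fun i hi => mem_range.1 (hN hi))]
  refine prod_subset hN fun i _ hi => ?_
  rw [Finsupp.notMem_support_iff.1 hi, hF]

/-! ### Uniqueness of Schur expansions -/

/-- The statistic `n(μ) = ∑ (i - 1) μ_i`, that is, the sum of the (zero-based) row indices of the
cells. -/
def rowSum (μ : YoungDiagram) : ℕ := ∑ c ∈ μ.cells, c.1

/-- The exponent vector `(μ_1, μ_2, …)`, as the content of the tableau of shape `μ` whose `i`-th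
row is filled with `i`. -/
noncomputable def weight (μ : YoungDiagram) : ℕ →₀ ℕ :=
  content (SemistandardYoungTableau.highestWeight μ)

theorem weight_eq (μ : YoungDiagram) : weight μ = ∑ c ∈ μ.cells, Finsupp.single c.1 1 := by
  refine sum_congr rfl fun c hc => ?_
  have : (c.1, c.2) ∈ μ := hc
  rw [SemistandardYoungTableau.highestWeight_apply, if_pos this]

theorem weight_apply (μ : YoungDiagram) (i : ℕ) : weight μ i = μ.rowLen i := by
  rw [weight_eq, Finsupp.finsetSum_apply, YoungDiagram.rowLen_eq_card, YoungDiagram.row,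
    card_filter]
  exact sum_congr rfl fun c _ => Finsupp.single_apply

theorem weight_injective : Function.Injective weight := fun μ ν h =>
  ext_rowLen fun i => by rw [← weight_apply, h, weight_apply]

/-- Columns increase strictly, so an entry is at least its (zero-based) row index. -/
theorem row_le_entry {μ : YoungDiagram} (T : SemistandardYoungTableau μ) {i j : ℕ}
    (h : (i, j) ∈ μ) : i ≤ T i j := by
  induction i with
  | zero => exact Nat.zero_le _
  | succ i ih =>
    exact (ih (μ.up_left_mem (Nat.le_succ i) le_rfl h)).trans_lt (T.col_strict (Nat.lt_succ_self i) h)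

/-- Triangularity of the transition matrix from Schur functions to monomials: the entries of a
tableau are at least the row indices, and the sum of the entries is determined by the content. -/
theorem rowSum_lt_or_eq_of_content_eq_weight {μ ν : YoungDiagram} (T : SemistandardYoungTableau ν)
    (hT : content T = weight μ) : rowSum ν < rowSum μ ∨ ν = μ := by
  -- `φ` sends a content to the sum of the entries.
  let φ : (ℕ →₀ ℕ) →+ ℕ := Finsupp.liftAddHom fun i => AddMonoidHom.mulLeft i
  have h1 : φ (content T) = ∑ c ∈ ν.cells, T c.1 c.2 := by
    rw [content, map_sum]
    simp [φ]
  have h2 : φ (weight μ) = rowSum μ := by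
    rw [weight_eq, map_sum]
    simp [φ, rowSum]
  have h3 : ∀ c ∈ ν.cells, c.1 ≤ T c.1 c.2 := fun c hc => row_le_entry T hc
  rw [← h2, ← hT, h1]
  rcases (sum_le_sum h3).lt_or_eq with h | h
  · exact Or.inl h
  · right
    rw [sum_eq_sum_iff_of_le h3] at h
    apply weight_injective
    rw [← hT, weight_eq, content]
    exact sum_congr rfl fun c hc => by rw [← h c hc]

/-- By triangularity, induction on `rowSum μ` isolates `c μ` in the coefficient of
`x^(weight μ)`. -/
theorem eq_zero_of_sum_mul_card_tableaux {c : YoungDiagram → ℤ}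
    (h : ∀ m : ℕ →₀ ℕ, ∑ ν ∈ diagrams m.degree, c ν * (#(tableaux ν m) : ℤ) = 0)
    (μ : YoungDiagram) : c μ = 0 := by
  induction hn : rowSum μ using Nat.strong_induction_on generalizing μ with
  | _ n ih =>
    have h1 := h (weight μ)
    have hμ : SemistandardYoungTableau.highestWeight μ ∈ tableaux μ (weight μ) :=
      mem_tableaux.2 rfl
    rw [sum_eq_single μ] at h1
    · refine (mul_eq_zero.1 h1).resolve_right ?_
      exact Nat.cast_ne_zero.2 (card_ne_zero_of_mem hμ)
    · intro ν _ hne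
      rcases (tableaux ν (weight μ)).eq_empty_or_nonempty with h0 | ⟨T, hT⟩
      · rw [h0, card_empty, Nat.cast_zero, mul_zero]
      · rcases rowSum_lt_or_eq_of_content_eq_weight T (mem_tableaux.1 hT) with hlt | heq
        · rw [ih _ (hn ▸ hlt) ν rfl, zero_mul]
        · exact absurd heq hne
    · intro h'
      refine absurd (mem_diagrams.2 ?_) h'
      rw [weight, degree_content]

open scoped MvPowerSeries.WithPiTopology in
theorem IsSchurExpansion.unique {F : Polynomial ℤ} {c c' : YoungDiagram → ℤ}
    (h : IsSchurExpansion F c) (h' : IsSchurExpansion F c') : c = c' := by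
  obtain ⟨P, hP, hc⟩ := h
  obtain ⟨P', hP', hc'⟩ := h'
  obtain rfl := hP.unique hP'
  funext μ
  refine sub_eq_zero.1 (eq_zero_of_sum_mul_card_tableaux (c := fun ν => c ν - c' ν) ?_ μ)
  intro m
  simp only [sub_mul, sum_sub_distrib]
  rw [← hasSum_smul_schur_iff.1 hc m, ← hasSum_smul_schur_iff.1 hc' m, sub_self]

/-! ### Sums over diagrams and expansions of determinants -/

theorem rowLen_injOn {n : ℕ} :
    Set.InjOn (fun (ν : YoungDiagram) (i : Fin n) => ν.rowLen i) {ν | ν.colLen 0 ≤ n} := by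
  intro μ hμ ν hν h
  refine ext_rowLen fun i => ?_
  by_cases hi : i < n
  · exact congrFun h ⟨i, hi⟩
  · rw [rowLen_eq_zero hμ (not_lt.1 hi), rowLen_eq_zero hν (not_lt.1 hi)]

/-- Diagrams with at most `n` rows are encoded by antitone vectors with `n` entries. -/
theorem sum_diagrams_eq_sum_rowLen {n M : ℕ} {p : YoungDiagram → Prop} [DecidablePred p]
    {S : Finset (Fin n → ℕ)}
    (hp : ∀ ν, p ν ↔ ν.colLen 0 ≤ n ∧ (fun i : Fin n => ν.rowLen i) ∈ S)
    (hS : ∀ b ∈ S, Antitone b) (g : (Fin n → ℕ) → ℤ) :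
    ∑ ν ∈ diagrams M with p ν, g (fun i => ν.rowLen i) = ∑ b ∈ S with ∑ i, b i = M, g b := by
  refine sum_bij (fun ν _ i => ν.rowLen i) ?_ ?_ ?_ fun _ _ => rfl
  · intro ν hν
    rw [mem_filter, mem_diagrams, hp] at hν
    rw [mem_filter, ← card_eq_sum_rowLen hν.2.1]
    exact ⟨hν.2.2, hν.1⟩
  · intro μ hμ ν hν h
    exact rowLen_injOn ((hp μ).1 (mem_filter.1 hμ).2).1 ((hp ν).1 (mem_filter.1 hν).2).1 h
  · intro b hb
    rw [mem_filter] at hb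
    obtain ⟨ν, h1, h2⟩ := exists_diagram_of_antitone b (hS b hb.1)
    have h3 : (fun i : Fin n => ν.rowLen i) = b := funext h2
    refine ⟨ν, mem_filter.2 ⟨mem_diagrams.2 ?_, (hp ν).2 ⟨h1, h3 ▸ hb.1⟩⟩, h3⟩
    rw [card_eq_sum_rowLen h1, ← hb.2, ← h3]

theorem det_sum_rows {R ι : Type*} [CommRing R] [Fintype ι] [DecidableEq ι]
    (S : ι → Finset ℕ) (g : ι → ℕ → ι → R) :
    (Matrix.of fun i j => ∑ b ∈ S i, g i b j).det =
      ∑ r ∈ Fintype.piFinset S, (Matrix.of fun i j => g i (r i) j).det := by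
  have := (Matrix.detRowAlternating (n := ι) (R := R)).toMultilinearMap.map_sum_finset g S
  convert this using 1
  · change Matrix.det _ = Matrix.det _
    congr 1
    ext i j
    simp
  · rfl

theorem det_eq_of_last_row {R : Type*} [CommRing R] {n : ℕ}
    (A : Matrix (Fin (n + 1)) (Fin (n + 1)) R) (h : ∀ j : Fin n, A (Fin.last n) j.castSucc = 0) :
    A.det = A (Fin.last n) (Fin.last n) * (A.submatrix Fin.castSucc Fin.castSucc).det := by
  rw [Matrix.det_succ_row A (Fin.last n), Fin.sum_univ_castSucc]
  simp [h, Fin.succAbove_last]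

theorem det_eq_of_forall_col_eq_smul_add_succ {R : Type*} [CommRing R] {n : ℕ}
    {A B : Matrix (Fin (n + 1)) (Fin (n + 1)) R} (c : Fin n → R)
    (hlast : ∀ i, A i (Fin.last n) = B i (Fin.last n))
    (hcast : ∀ i (j : Fin n), A i j.castSucc = B i j.castSucc + c j * A i j.succ) :
    A.det = B.det := by
  rw [← Matrix.det_submatrix_equiv_self Fin.revPerm A,
    ← Matrix.det_submatrix_equiv_self Fin.revPerm B]
  refine Matrix.det_eq_of_forall_col_eq_smul_add_pred (fun j => c j.rev) (fun i => ?_) fun i j => ?_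
  · simp [hlast]
  · simp [Fin.rev_succ, Fin.rev_castSucc, hcast]

open Polynomial in
/-- Comparison of the coefficients of `X ^ (M + k)` in a weighted sum. -/
theorem sum_filter_eq_of_polynomial_eq {ι : Type*} [DecidableEq ι] {S : Finset ι} {w : ι → ℕ}
    {g : ι → ℤ} {F : ℤ[X]} {M : ℕ} {g₀ : ℤ}
    (h : ∑ b ∈ S, X ^ w b * C (g b) = F * (X ^ M * C g₀)) (k : ℕ) :
    ∑ b ∈ S with w b = M + k, g b = F.coeff k * g₀ := by
  have h' := congrArg (fun p => coeff p (M + k)) h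
  simp only [finsetSum_coeff, coeff_mul_C, coeff_X_pow, ite_mul, one_mul, zero_mul] at h'
  rw [← mul_assoc, coeff_mul_C, add_comm M k, coeff_mul_X_pow] at h'
  rw [← h', sum_filter, add_comm M k]
  exact sum_congr rfl fun b _ => if_congr eq_comm rfl rfl

/-! ### The Pieri recursion for Jacobi-Trudi determinants -/

theorem coeffInt_of_neg (F : Polynomial ℤ) {x : ℤ} (h : x < 0) : coeffInt F x = 0 :=
  if_neg (not_le.2 h)

theorem coeffInt_natCast (F : Polynomial ℤ) (x : ℕ) : coeffInt F x = F.coeff x := by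
  simp [coeffInt]

theorem coeffInt_of_natDegree_lt (F : Polynomial ℤ) {x : ℤ} (h : F.natDegree < x) :
    coeffInt F x = 0 := by
  obtain ⟨x, rfl⟩ := Int.eq_ofNat_of_zero_le ((Int.natCast_nonneg _).trans h.le)
  rw [coeffInt_natCast, Polynomial.coeff_eq_zero_of_natDegree_lt (by exact_mod_cast h)]

/-- The matrix `(f_{a_i - i + j})_{1 ≤ i, j ≤ n}`. -/
noncomputable def shiftMatrix (F : Polynomial ℤ) (n : ℕ) (a : Fin n → ℕ) :
    Matrix (Fin n) (Fin n) ℤ :=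
  Matrix.of fun i j => coeffInt F ((a i : ℤ) - (i : ℤ) + (j : ℤ))

/-- Trailing parts of size zero do not change the Jacobi-Trudi determinant. -/
theorem det_jacobiTrudi {F : Polynomial ℤ} (hF : F.coeff 0 = 1) {μ : YoungDiagram} {n : ℕ}
    (h : μ.colLen 0 ≤ n) :
    (jacobiTrudi F μ).det = (shiftMatrix F n fun i => μ.rowLen i).det := by
  induction n, h using Nat.le_induction with
  | base => rfl
  | succ n hn ih =>
    have h0 : μ.rowLen n = 0 := rowLen_eq_zero hn le_rfl
    rw [ih, det_eq_of_last_row (shiftMatrix F (n + 1) fun i => μ.rowLen i)]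
    · simp only [shiftMatrix, Matrix.of_apply, Fin.val_last, h0, Nat.cast_zero, zero_sub,
        neg_add_cancel]
      rw [← Nat.cast_zero (R := ℤ), coeffInt_natCast, hF, one_mul]
      rfl
    · intro j
      simp only [shiftMatrix, Matrix.of_apply, Fin.val_last, h0, Fin.val_castSucc]
      exact coeffInt_of_neg F (by omega)

open Polynomial in
/-- The determinantal form of the Pieri rule. If `ν / μ` is a horizontal strip, then the part `ν_i`
ranges over the interval `[μ_i, μ_{i-1}]`, independently of the other parts. Hence the sum of the
determinants of all `ν` is a single determinant. Row operations extend all these intervals upwards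
without bound, and column operations then remove the sums from all columns but the last. -/
theorem sum_piFinset_det_shiftMatrix (F : ℤ[X]) {μ : YoungDiagram} {n : ℕ}
    (hμ : μ.colLen 0 ≤ n) {B : ℕ} (hB : F.natDegree < B) (hμB : μ.rowLen 0 ≤ B) :
    ∑ b ∈ Fintype.piFinset (fun i : Fin (n + 1) =>
        Ico (μ.rowLen i) (if (i : ℕ) = 0 then B else μ.rowLen (i - 1) + 1)),
      X ^ (∑ i, b i) * C (shiftMatrix F (n + 1) b).det =
    F * (X ^ μ.card * C (shiftMatrix F n fun i => μ.rowLen i).det) := by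
  have hle : ∀ i, μ.rowLen i ≤ B := fun i => (μ.rowLen_anti 0 i (Nat.zero_le i)).trans hμB
  let g : ℕ → ℕ → ℕ → ℤ[X] := fun i j b => X ^ b * C (coeffInt F ((b : ℤ) - (i : ℤ) + (j : ℤ)))
  -- `Q` has all intervals extended up to a bound beyond which the coefficients of `F` vanish; `M`
  -- keeps these sums in its last column only.
  let Q : Matrix (Fin (n + 1)) (Fin (n + 1)) ℤ[X] :=
    Matrix.of fun i j => ∑ b ∈ Ico (μ.rowLen i) (B + i), g i j b
  let M : Matrix (Fin (n + 1)) (Fin (n + 1)) ℤ[X] :=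
    Matrix.of fun i j => if j = Fin.last n then Q i j else g i j (μ.rowLen i)
  have hdet : ∀ (N : ℕ) (a : Fin N → ℕ), (Matrix.of fun i j : Fin N => g i j (a i)).det =
      X ^ (∑ i, a i) * C (shiftMatrix F N a).det := by
    intro N a
    rw [← prod_pow_eq_pow_sum, RingHom.map_det, ← Matrix.det_mul_column]
    rfl
  calc _ = (Matrix.of fun i j : Fin (n + 1) => ∑ b ∈
          Ico (μ.rowLen i) (if (i : ℕ) = 0 then B else μ.rowLen (i - 1) + 1), g i j b).det := by
        refine Eq.trans (sum_congr rfl fun b _ => (hdet _ _).symm)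
          (det_sum_rows _ fun (i : Fin (n + 1)) b (j : Fin (n + 1)) => g i j b).symm
    _ = Q.det := by
        symm
        refine Matrix.det_eq_of_forall_row_eq_smul_add_pred (fun _ => X) (fun j => ?_)
          fun i j => ?_
        · simp [Q]
        · simp only [Q, Matrix.of_apply, Fin.val_succ, Fin.val_castSucc, Nat.succ_ne_zero, if_false,
            Nat.add_sub_cancel]
          rw [← sum_Ico_consecutive _ (n := μ.rowLen i + 1) ((μ.rowLen_anti i (i + 1) (Nat.le_succ _)).trans
            (Nat.le_succ _)) (show μ.rowLen i + 1 ≤ B + (i + 1) by have := hle i; omega),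
            ← add_assoc B, ← sum_Ico_add', mul_sum]
          congr 1
          refine sum_congr rfl fun b _ => ?_
          simp only [g]
          rw [pow_succ', mul_assoc]
          congr 4
          push_cast
          ring
    _ = M.det := by
        refine det_eq_of_forall_col_eq_smul_add_succ (fun _ => X) (fun i => ?_) fun i j => ?_
        · simp [M]
        · have hj : j.castSucc ≠ Fin.last n := (Fin.castSucc_lt_last j).ne
          simp only [M, Q, Matrix.of_apply, if_neg hj, Fin.val_succ, Fin.val_castSucc]
          have hlt : μ.rowLen i < B + i + 1 := by have := hle i; omega
          have htop : g i j (B + i) = 0 := by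
            simp only [g]
            rw [coeffInt_of_natDegree_lt F (by push_cast; omega), C_0, mul_zero]
          rw [← add_zero (∑ b ∈ Ico (μ.rowLen i) (B + i), g i j b), ← htop,
            ← sum_Ico_succ_top (by have := hle i; omega), sum_eq_sum_Ico_succ_bot hlt,
            ← sum_Ico_add', mul_sum]
          congr 1
          refine sum_congr rfl fun b _ => ?_
          simp only [g]
          rw [pow_succ', mul_assoc]
          congr 4
          push_cast
          ring
    _ = _ := by
        have h0 : μ.rowLen n = 0 := rowLen_eq_zero hμ le_rfl
        rw [det_eq_of_last_row]
        · congr 1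
          · simp only [M, Q, Matrix.of_apply, Fin.val_last, h0, if_true, ← range_eq_Ico, g]
            rw [F.as_sum_range' (B + n) (by omega)]
            refine sum_congr rfl fun b _ => ?_
            rw [sub_add_cancel, coeffInt_natCast, ← F.as_sum_range' (B + n) (by omega),
              ← C_mul_X_pow_eq_monomial, mul_comm]
          · rw [card_eq_sum_rowLen hμ, ← hdet]
            congr 1
            ext1 i j
            simp [M, (Fin.castSucc_lt_last j).ne]
        · intro j
          simp only [M, Matrix.of_apply, if_neg (Fin.castSucc_lt_last j).ne, Fin.val_last, g,
            Fin.val_castSucc, h0]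
          rw [coeffInt_of_neg F (by omega), C_0, mul_zero]

theorem satisfiesPieri_det_jacobiTrudi {F : Polynomial ℤ} (hF : F.coeff 0 = 1) :
    SatisfiesPieri F fun μ => (jacobiTrudi F μ).det := by
  classical
  intro μ k
  let n := μ.colLen 0
  -- This bound exceeds the first part of every `ν` with `|ν| = |μ| + k`, and makes the row of any
  -- larger first part vanish.
  let B := F.natDegree + (μ.card + k) + 1
  have hB : μ.rowLen 0 ≤ B := (rowLen_le_card μ 0).trans (by omega)
  have h := sum_filter_eq_of_polynomial_eq
    (sum_piFinset_det_shiftMatrix F (le_refl n) (show F.natDegree < B by omega) hB) k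
  simp only
  rw [det_jacobiTrudi hF (le_refl n), ← h]
  set S := Fintype.piFinset (fun i : Fin (n + 1) =>
    Ico (μ.rowLen i) (if (i : ℕ) = 0 then B else μ.rowLen (i - 1) + 1)) with hS
  have hmem : ∀ b : Fin (n + 1) → ℕ, b ∈ S ↔ ∀ i : Fin (n + 1), μ.rowLen i ≤ b i ∧
      b i < if (i : ℕ) = 0 then B else μ.rowLen (i - 1) + 1 := by
    intro b
    simp only [hS, Fintype.mem_piFinset, mem_Ico]
  rw [← sum_diagrams_eq_sum_rowLen (n := n + 1)
    (p := fun ν => ν.colLen 0 ≤ n + 1 ∧ (fun i : Fin (n + 1) => ν.rowLen i) ∈ S)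
    (S := S) (fun ν => Iff.rfl)]
  · refine sum_congr ?_ ?_
    · refine filter_congr fun ν hν => ?_
      rw [mem_diagrams] at hν
      rw [hmem]
      constructor
      · intro hs
        refine ⟨(isHorizontalStrip_iff_colLen.1 hs 0).2, fun i => ?_⟩
        rw [isHorizontalStrip_iff_rowLen] at hs
        refine ⟨(hs i).1, ?_⟩
        split_ifs with hi
        · have := rowLen_le_card ν i
          omega
        · obtain ⟨i', hi'⟩ := Nat.exists_eq_succ_of_ne_zero hi
          rw [hi']
          exact Nat.lt_succ_of_le (hs i').2
      · rintro ⟨h1, h2⟩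
        rw [isHorizontalStrip_iff_rowLen]
        intro i
        constructor
        · by_cases hi : i < n + 1
          · exact (h2 ⟨i, hi⟩).1
          · rw [rowLen_eq_zero (le_refl n) (by omega)]
            exact Nat.zero_le _
        · by_cases hi : i + 1 < n + 1
          · have := (h2 ⟨i + 1, hi⟩).2
            rw [if_neg (Nat.succ_ne_zero i)] at this
            exact Nat.lt_succ_iff.1 this
          · rw [rowLen_eq_zero h1 (by omega)]
            exact Nat.zero_le _
    · intro ν hν
      exact det_jacobiTrudi hF (mem_filter.1 hν).2.1
  · intro b hb i j hij
    rw [hmem] at hb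
    rcases hij.eq_or_lt with rfl | hlt
    · exact le_rfl
    · have h1 := (hb j).2
      have hlt' : (i : ℕ) < j := hlt
      rw [if_neg (by omega)] at h1
      exact (Nat.lt_succ_iff.1 h1).trans ((μ.rowLen_anti i (j - 1) (by omega)).trans (hb i).1)

theorem det_jacobiTrudi_bot (F : Polynomial ℤ) : (jacobiTrudi F ⊥).det = 1 := by
  have h : (⊥ : YoungDiagram).colLen 0 = 0 := by
    by_contra h
    exact YoungDiagram.notMem_bot _ (YoungDiagram.mem_iff_lt_colLen.2 (Nat.pos_of_ne_zero h))
  have : IsEmpty (Fin ((⊥ : YoungDiagram).colLen 0)) := by rw [h]; infer_instance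
  exact Matrix.det_isEmpty

/-! ### Determinants of residues modulo `d + 1` -/

/-- The residue of the `c`-th entry of the staircase `δ_{d+1}` modulo `d + 1`, as a bijection. -/
def residueEquiv (d : ℕ) : Fin (d + 1) ≃ ZMod (d + 1) :=
  Fin.revPerm.trans (ZMod.finEquiv (d + 1)).toEquiv

theorem residueEquiv_apply (d : ℕ) (c : Fin (d + 1)) :
    residueEquiv d c = ((delta (d + 1) c : ℕ) : ZMod (d + 1)) := by
  exact (ZMod.natCast_zmod_val (n := d + 1) (show ZMod (d + 1) from c.rev)).symm

theorem natCast_eq_residueEquiv_iff {d m : ℕ} (hm : m ≤ d) (c : Fin (d + 1)) :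
    (m : ZMod (d + 1)) = residueEquiv d c ↔ m + c = d := by
  have hc : delta (d + 1) c = d - c := by simp [delta, Fin.val_rev]
  rw [residueEquiv_apply, ZMod.natCast_eq_natCast_iff, hc, Nat.ModEq,
    Nat.mod_eq_of_lt (Nat.lt_succ_of_le hm), Nat.mod_eq_of_lt (by omega)]
  have := c.2
  omega

section

variable (R : Type*) [CommRing R] {d : ℕ}

/-- The unit vector of the residue class `x` modulo `d + 1`; the coordinates are listed from the
residue `d` down to the residue `0`. -/
def residueRow (x : ZMod (d + 1)) (c : Fin (d + 1)) : R :=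
  if x = residueEquiv d c then 1 else 0

variable {R}

/-- The square matrix with the given rows below a first row of ones. -/
def bordered (v : Fin d → Fin (d + 1) → R) : Matrix (Fin (d + 1)) (Fin (d + 1)) R :=
  Matrix.of (Matrix.vecCons 1 v)

@[simp]
theorem bordered_zero (v : Fin d → Fin (d + 1) → R) (c : Fin (d + 1)) : bordered v 0 c = 1 := rfl

@[simp]
theorem bordered_succ (v : Fin d → Fin (d + 1) → R) (i : Fin d) (c : Fin (d + 1)) :
    bordered v i.succ c = v i c := rfl

theorem det_bordered_sum (S : Fin d → Finset ℕ) (g : Fin d → ℕ → Fin (d + 1) → R) :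
    (bordered fun i => ∑ b ∈ S i, g i b).det =
      ∑ b ∈ Fintype.piFinset S, (bordered fun i => g i (b i)).det :=
  ((Matrix.detRowAlternating (n := Fin (d + 1)) (R := R)).toMultilinearMap.curryLeft
    1).map_sum_finset g S

theorem det_bordered_smul (a : Fin d → R) (v : Fin d → Fin (d + 1) → R) :
    (bordered fun i => a i • v i).det = (∏ i, a i) * (bordered v).det :=
  ((Matrix.detRowAlternating (n := Fin (d + 1)) (R := R)).toMultilinearMap.curryLeft
    1).map_smul_univ a v

variable (R) in
theorem det_bordered_delta :
    (bordered fun i : Fin d => residueRow R (d := d) (delta d i : ℕ)).det = 1 := by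
  have key : ∀ (i : Fin d) (c : Fin (d + 1)),
      residueRow R (d := d) (delta d i : ℕ) c = if c = i.succ then 1 else 0 := by
    intro i c
    refine if_congr ?_ rfl rfl
    have hi := i.2
    have h : delta d i = d - (i + 1) := by simp [delta, Fin.val_rev]
    rw [natCast_eq_residueEquiv_iff (by omega), Fin.ext_iff, h, Fin.val_succ]
    omega
  rw [Matrix.det_of_isUpperTriangular]
  · refine prod_eq_one fun i _ => ?_
    refine Fin.cases ?_ (fun i => ?_) i
    · rfl
    · rw [bordered_succ, key, if_pos rfl]
  · intro i c
    refine Fin.cases ?_ (fun i => ?_) i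
    · intro h
      exact absurd h (Fin.not_lt_zero c)
    · intro h
      rw [bordered_succ, key]
      exact if_neg (ne_of_lt h)

open Polynomial in
/-- For the staircase, the matrix is bidiagonal below the row of ones; adding `X` times each column
to the preceding one, starting from the right, makes it upper triangular. -/
theorem det_bordered_delta_sub :
    (bordered fun i : Fin d => residueRow ℤ[X] (d := d) (delta d i : ℕ) -
      (X : ℤ[X]) • residueRow ℤ[X] ((delta d i : ℕ) + 1 : ZMod (d + 1))).det = truncF d := by
  have key : ∀ (i : Fin d) (c : Fin (d + 1)),
      (residueRow ℤ[X] (d := d) (delta d i : ℕ) -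
        (X : ℤ[X]) • residueRow ℤ[X] ((delta d i : ℕ) + 1 : ZMod (d + 1))) c =
      (if c = i.succ then 1 else 0) - X * if c = i.castSucc then 1 else 0 := by
    intro i c
    have hi := i.2
    have h : delta d i = d - (i + 1) := by simp [delta, Fin.val_rev]
    rw [Pi.sub_apply, Pi.smul_apply, smul_eq_mul, residueRow, residueRow, ← Nat.cast_succ]
    refine congrArg₂ (fun a b => a - X * b) (if_congr ?_ rfl rfl) (if_congr ?_ rfl rfl)
    · rw [natCast_eq_residueEquiv_iff (by omega), Fin.ext_iff, h, Fin.val_succ]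
      omega
    · rw [natCast_eq_residueEquiv_iff (by omega), Fin.ext_iff, h, Fin.val_castSucc]
      omega
  let W : Matrix (Fin (d + 1)) (Fin (d + 1)) ℤ[X] :=
    Matrix.of (Matrix.vecCons (fun c => ∑ k ∈ range (d + 1 - c), X ^ k)
      fun i c => if c = i.succ then 1 else 0)
  have hW0 : ∀ c, W 0 c = ∑ k ∈ range (d + 1 - c), X ^ k := fun c => rfl
  have hW : ∀ (i : Fin d) c, W i.succ c = if c = i.succ then 1 else 0 := fun i c => rfl
  have h1 : W.det = _ := det_eq_of_forall_col_eq_smul_add_succ (A := W)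
    (B := bordered fun i : Fin d => residueRow ℤ[X] (d := d) (delta d i : ℕ) -
      (X : ℤ[X]) • residueRow ℤ[X] ((delta d i : ℕ) + 1 : ZMod (d + 1))) (fun _ => X)
    (fun i => by
      refine Fin.cases ?_ (fun i => ?_) i
      · simp [hW0]
      · rw [bordered_succ, key, hW, if_neg (c := Fin.last d = i.castSucc)
          (Fin.castSucc_lt_last i).ne', mul_zero, sub_zero])
    (fun i c => by
      refine Fin.cases ?_ (fun i => ?_) i
      · rw [bordered_zero, hW0, hW0, Fin.val_castSucc, Fin.val_succ, Nat.add_sub_add_right,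
          show d + 1 - c = (d - c) + 1 by omega, sum_range_succ', mul_sum, add_comm, pow_zero]
        simp only [pow_succ']
      · rw [bordered_succ, key, hW, hW]
        simp only [Fin.castSucc_inj, Fin.succ_inj]
        ring)
  rw [← h1, Matrix.det_of_isUpperTriangular, Fin.prod_univ_succ, hW0]
  · simp [hW, truncF]
  · intro i c
    refine Fin.cases ?_ (fun i => ?_) i
    · intro h
      exact absurd h (Fin.not_lt_zero c)
    · intro h
      rw [hW]
      exact if_neg (ne_of_lt h)

open Polynomial in
/-- With `C` the cyclic shift of the residues, the row `e_x - t e_{x+1}` is the image of the unit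
vector `e_x` under `1 - t C`, and the row of ones is an eigenvector of `1 - t C` for the eigenvalue
`1 - t`. Hence replacing each `e_x` by `e_x - t e_{x+1}` multiplies the determinant by the scalar
`det (1 - t C) / (1 - t)`, which the staircase determines. -/
theorem det_bordered_sub (x : Fin d → ZMod (d + 1)) :
    (bordered fun i => residueRow ℤ[X] (x i) - (X : ℤ[X]) • residueRow ℤ[X] (x i + 1)).det =
      truncF d * (bordered fun i => residueRow ℤ[X] (x i)).det := by
  let U : Matrix (Fin (d + 1)) (Fin (d + 1)) ℤ[X] := Matrix.of fun a c =>
    residueRow ℤ[X] (residueEquiv d a) c - X * residueRow ℤ[X] (residueEquiv d a + 1) c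
  have hU : ∀ x : Fin d → ZMod (d + 1), (bordered fun i => residueRow ℤ[X] (x i)).det * U.det =
      (1 - X) * (bordered fun i =>
        residueRow ℤ[X] (x i) - (X : ℤ[X]) • residueRow ℤ[X] (x i + 1)).det := by
    intro x
    have hprod : ∏ i, (Matrix.vecCons (1 - X) (fun _ => 1) : Fin (d + 1) → ℤ[X]) i = 1 - X := by
      rw [Fin.prod_univ_succ]
      simp
    rw [← Matrix.det_mul, ← hprod, ← Matrix.det_mul_column]
    congr 1
    ext1 i c
    rw [Matrix.mul_apply, Matrix.of_apply]
    refine Fin.cases ?_ (fun i => ?_) i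
    · simp only [bordered_zero, one_mul, mul_one, U, Matrix.of_apply, Matrix.cons_val_zero]
      have h0 := Equiv.sum_comp (residueEquiv d) (fun y => residueRow ℤ[X] y c)
      have h1 : ∑ a, residueRow ℤ[X] (residueEquiv d a + 1) c = _ :=
        Equiv.sum_comp ((residueEquiv d).trans (Equiv.addRight 1)) (fun y => residueRow ℤ[X] y c)
      rw [sum_sub_distrib, ← mul_sum, h0, h1]
      simp [residueRow]
    · simp only [bordered_succ, Matrix.cons_val_succ, one_mul, U, Matrix.of_apply]
      rw [sum_eq_single ((residueEquiv d).symm (x i))]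
      · simp [residueRow]
      · intro a _ ha
        rw [residueRow, if_neg, zero_mul]
        rintro h
        exact ha (by rw [h, Equiv.symm_apply_apply])
      · exact fun h => absurd (mem_univ _) h
  have hdelta := hU fun i => (delta d i : ℕ)
  rw [det_bordered_delta, one_mul, det_bordered_delta_sub] at hdelta
  have hX : (1 - X : ℤ[X]) ≠ 0 := fun h => by
    have := congrArg (fun p : ℤ[X] => p.coeff 0) h
    simp at this
  apply mul_left_cancel₀ hX
  rw [← hU, hdelta]
  ring

end

/-! ### The Pieri recursion for the residue determinants -/

/-- The determinant of the residues of `b + δ_d` modulo `d + 1`, with the sign `(-1)^{|b|}`. -/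
def residueDet (d : ℕ) (b : Fin d → ℕ) : ℤ :=
  (-1) ^ (∑ i, b i) *
    (bordered fun i => residueRow ℤ (d := d) ((b i + delta d i : ℕ) : ZMod (d + 1))).det

/-- The coefficient of `s_μ` in `∏_i F(x_i)` for `F = 1 + t + ⋯ + t^d`, as a determinant of the
residues of `μ' + δ_d`; it is zero if `μ'` has more than `d` parts. -/
def residueCoeff (d : ℕ) (μ : YoungDiagram) : ℤ :=
  if μ.rowLen 0 ≤ d then residueDet d fun i => μ.colLen i else 0

open Polynomial in
/-- Adding a vertical strip to `a` raises each entry by `0` or `1`. The sum over all choices is a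
single determinant by multilinearity. -/
theorem sum_piFinset_residueDet {d : ℕ} (a : Fin d → ℕ) :
    ∑ b ∈ Fintype.piFinset (fun i => {a i, a i + 1}), X ^ (∑ i, b i) * C (residueDet d b) =
      truncF d * (X ^ (∑ i, a i) * C (residueDet d a)) := by
  have hdet : ∀ b : Fin d → ℕ, X ^ (∑ i, b i) * C (residueDet d b) =
      (bordered fun i => (-X : ℤ[X]) ^ b i •
        residueRow ℤ[X] (d := d) ((b i + delta d i : ℕ) : ZMod (d + 1))).det := by
    intro b
    rw [det_bordered_smul, prod_pow_eq_pow_sum, residueDet, C_mul, neg_pow (X : ℤ[X]), RingHom.map_det, C_pow,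
      C_neg, C_1, ← mul_assoc, mul_comm (X ^ _)]
    congr 2
    ext1 i c
    refine Fin.cases ?_ (fun i => ?_) i
    · simp
    · simp only [RingHom.mapMatrix_apply, Matrix.map_apply, bordered_succ, residueRow]
      split_ifs <;> simp
  rw [sum_congr rfl fun b _ => hdet b, hdet a, ← det_bordered_sum (g := fun i m =>
    (-X : ℤ[X]) ^ m • residueRow ℤ[X] (d := d) ((m + delta d i : ℕ) : ZMod (d + 1))),
    det_bordered_smul, mul_left_comm, ← det_bordered_sub, ← det_bordered_smul]
  congr 2
  funext i
  rw [sum_pair (Nat.succ_ne_self _).symm, pow_succ, mul_neg, neg_smul, ← sub_eq_add_neg, mul_smul,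
    ← smul_sub]
  congr 4
  push_cast
  ring

theorem residueDet_eq_zero_of_eq {d : ℕ} {b : Fin d → ℕ} {i j : Fin d} (hij : i ≠ j)
    (h : b i + delta d i = b j + delta d j) : residueDet d b = 0 := by
  rw [residueDet, Matrix.det_zero_of_row_eq (i := i.succ) (j := j.succ)
    (fun h' => hij (Fin.succ_injective _ h')), mul_zero]
  funext c
  simp only [bordered_succ, h]

/-- A vector `b` obtained from an antitone vector by adding a vertical strip that is not itself
antitone has an ascent by one, so that `b + δ_d` has a repeated entry. -/
theorem residueDet_eq_zero_of_not_antitone {d : ℕ} {a b : Fin d → ℕ} (ha : Antitone a)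
    (hab : ∀ i, a i ≤ b i ∧ b i ≤ a i + 1) (hb : ¬ Antitone b) : residueDet d b = 0 := by
  cases d with
  | zero => exact absurd (fun i => i.elim0) hb
  | succ d =>
    rw [Fin.antitone_iff_succ_le] at hb
    push Not at hb
    obtain ⟨i, hi⟩ := hb
    refine residueDet_eq_zero_of_eq (i := i.castSucc) (j := i.succ) (Fin.castSucc_lt_succ).ne ?_
    have h1 := ha (Fin.castSucc_lt_succ (i := i)).le
    have h2 := hab i.castSucc
    have h3 := hab i.succ
    have h4 := i.2
    simp only [delta, Fin.val_rev, Fin.val_castSucc, Fin.val_succ]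
    omega

theorem satisfiesPieri_residueCoeff (d : ℕ) : SatisfiesPieri (truncF d) (residueCoeff d) := by
  classical
  intro μ k
  by_cases hμ : μ.rowLen 0 ≤ d
  swap
  · rw [residueCoeff, if_neg hμ, mul_zero]
    refine sum_eq_zero fun ν hν => if_neg fun h => hμ ?_
    exact ((isHorizontalStrip_iff_rowLen.1 (mem_filter.1 hν).2 0).1).trans h
  let a : Fin d → ℕ := fun i => μ.colLen i
  have ha : Antitone a := fun i j hij => μ.colLen_anti i j hij
  have hcard : ∑ i, a i = μ.card := by
    rw [← card_transpose, card_eq_sum_rowLen (n := d) (by rwa [YoungDiagram.colLen_transpose])]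
    simp [a]
  have h := sum_filter_eq_of_polynomial_eq (sum_piFinset_residueDet a) k
  rw [residueCoeff, if_pos hμ, ← h, hcard]
  set S := Fintype.piFinset fun i => ({a i, a i + 1} : Finset ℕ) with hS
  have hmem : ∀ b, b ∈ S ↔ ∀ i, a i ≤ b i ∧ b i ≤ a i + 1 := by
    intro b
    simp only [hS, Fintype.mem_piFinset, mem_insert, mem_singleton]
    exact forall_congr' fun i => by omega
  calc ∑ ν ∈ diagrams (μ.card + k) with IsHorizontalStrip μ ν, residueCoeff d ν
      = ∑ ν ∈ diagrams (μ.card + k) with (ν.colLen 0 ≤ d ∧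
          (fun i : Fin d => ν.rowLen i) ∈ {b ∈ S | Antitone b}), residueDet d fun i => ν.rowLen i := by
        rw [sum_filter, sum_filter]
        refine sum_equiv YoungDiagram.transposeOrderIso.toEquiv (fun ν => ?_) fun ν _ => ?_
        · simp [card_transpose]
        · have hanti : Antitone fun i : Fin d => ν.colLen i := fun i j hij => ν.colLen_anti i j hij
          simp only [RelIso.coe_fn_toEquiv, YoungDiagram.transposeOrderIso_apply,
            YoungDiagram.colLen_transpose, YoungDiagram.rowLen_transpose, mem_filter, hmem, hanti,
            and_true, residueCoeff]
          by_cases hν : ν.rowLen 0 ≤ d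
          · simp only [hν, if_true, true_and]
            refine if_congr ?_ rfl rfl
            rw [isHorizontalStrip_iff_colLen]
            refine ⟨fun h i => h i, fun h j => ?_⟩
            by_cases hj : j < d
            · exact h ⟨j, hj⟩
            · have h1 := rowLen_eq_zero (μ := μ.transpose) (i := j)
                (by rwa [YoungDiagram.colLen_transpose]) (not_lt.1 hj)
              have h2 := rowLen_eq_zero (μ := ν.transpose) (i := j)
                (by rwa [YoungDiagram.colLen_transpose]) (not_lt.1 hj)
              rw [YoungDiagram.rowLen_transpose] at h1 h2
              omega
          · simp [hν]
    _ = ∑ b ∈ S with ∑ i, b i = μ.card + k, residueDet d b := by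
        rw [sum_diagrams_eq_sum_rowLen (fun ν => Iff.rfl) (fun b hb => (mem_filter.1 hb).2),
          filter_filter]
        refine sum_subset (fun b hb => ?_) fun b hb hb' => ?_
        · rw [mem_filter] at hb ⊢
          exact ⟨hb.1, hb.2.2⟩
        · rw [mem_filter] at hb hb'
          exact residueDet_eq_zero_of_not_antitone ha ((hmem b).1 hb.1)
            fun h => hb' ⟨hb.1, h, hb.2⟩

theorem residueCoeff_bot (d : ℕ) : residueCoeff d ⊥ = 1 := by
  have hr : (⊥ : YoungDiagram).rowLen 0 = 0 := by
    by_contra h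
    exact YoungDiagram.notMem_bot _ (YoungDiagram.mem_iff_lt_rowLen.2 (Nat.pos_of_ne_zero h))
  have hc : ∀ j, (⊥ : YoungDiagram).colLen j = 0 := by
    intro j
    by_contra h
    exact YoungDiagram.notMem_bot _ (YoungDiagram.mem_iff_lt_colLen.2 (Nat.pos_of_ne_zero h))
  rw [residueCoeff, if_pos (by omega), residueDet]
  simp only [hc, sum_const_zero, pow_zero, one_mul, zero_add]
  exact det_bordered_delta ℤ

/-! ### Evaluation of the residue determinants -/

theorem matches_iff {d : ℕ} {μ : YoungDiagram} {r : Fin (d + 1)} {σ : Equiv.Perm (Fin d)} :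
    Matches d μ r σ ↔ μ.rowLen 0 ≤ d ∧ ∀ i : Fin d,
      ((μ.colLen i + delta d i : ℕ) : ZMod (d + 1)) =
        residueEquiv d (r.rev.succAbove (σ i)) := by
  simp only [Matches, YoungDiagram.colLen_transpose, YoungDiagram.rowLen_transpose, deltaRemove,
    residueEquiv_apply]

theorem residueCoeff_eq_neg_one_pow_mul {d : ℕ} {μ : YoungDiagram} (hμ : μ.rowLen 0 ≤ d) :
    residueCoeff d μ = (-1) ^ μ.card * (bordered fun i =>
      residueRow ℤ (d := d) ((μ.colLen i + delta d i : ℕ) : ZMod (d + 1))).det := by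
  rw [residueCoeff, if_pos hμ, residueDet, ← card_transpose,
    card_eq_sum_rowLen (n := d) (by rwa [YoungDiagram.colLen_transpose])]
  simp

/-- If the residues are those of `δ_{d+1} ∖ r` permuted by `σ`, then in the expansion along the row
of ones only the minor that omits the column of the residue `r` survives, and this minor is the
permutation matrix of `σ`. -/
theorem residueCoeff_of_matches {d : ℕ} {μ : YoungDiagram} {r : Fin (d + 1)}
    {σ : Equiv.Perm (Fin d)} (h : Matches d μ r σ) :
    residueCoeff d μ = (-1) ^ (μ.card + d + (r : ℕ)) * (Equiv.Perm.sign σ : ℤ) := by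
  obtain ⟨hμ, hx⟩ := matches_iff.1 h
  rw [residueCoeff_eq_neg_one_pow_mul hμ, Matrix.det_succ_row_zero, sum_eq_single r.rev]
  · have hperm : (bordered fun i => residueRow ℤ (d := d)
        ((μ.colLen i + delta d i : ℕ) : ZMod (d + 1))).submatrix Fin.succ r.rev.succAbove =
        σ.permMatrix ℤ := by
      ext i j
      rw [Matrix.submatrix_apply, bordered_succ, residueRow, hx, Equiv.Perm.permMatrix,
        PEquiv.toMatrix_apply]
      refine if_congr ?_ rfl rfl
      simp [eq_comm]
    rw [hperm, Matrix.det_permutation, bordered_zero, mul_one, ← mul_assoc, ← pow_add]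
    congr 1
    have hr := r.2
    have h1 : μ.card + d + r = μ.card + (r.rev : ℕ) + 2 * r := by
      rw [Fin.val_rev]
      omega
    rw [h1, pow_add _ _ (2 * _), pow_mul, neg_one_sq, one_pow, mul_one]
  · intro c _ hc
    obtain ⟨j, hj⟩ := Fin.exists_succAbove_eq hc.symm
    rw [Matrix.det_eq_zero_of_column_eq_zero j, mul_zero]
    intro i
    rw [Matrix.submatrix_apply, bordered_succ, residueRow, hx, hj, if_neg]
    exact fun h' => Fin.succAbove_ne _ _ ((residueEquiv d).injective h')
  · exact fun h' => absurd (mem_univ _) h'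

theorem exists_matches_of_residueCoeff_ne_zero {d : ℕ} {μ : YoungDiagram}
    (h : residueCoeff d μ ≠ 0) : ∃ r σ, Matches d μ r σ := by
  have hμ : μ.rowLen 0 ≤ d := by
    by_contra hμ
    exact h (if_neg hμ)
  rw [residueCoeff_eq_neg_one_pow_mul hμ, Matrix.det_succ_row_zero] at h
  obtain ⟨c, -, hc⟩ := exists_ne_zero_of_sum_ne_zero (right_ne_zero_of_mul h)
  have hc := right_ne_zero_of_mul hc
  rw [Matrix.det_apply'] at hc
  obtain ⟨σ, -, hσ⟩ := exists_ne_zero_of_sum_ne_zero hc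
  have hσ := prod_ne_zero_iff.1 (right_ne_zero_of_mul hσ)
  refine ⟨c.rev, σ⁻¹, matches_iff.2 ⟨hμ, fun i => ?_⟩⟩
  have hinv : σ (σ⁻¹ i) = i := σ.apply_symm_apply i
  have hi := hσ (σ⁻¹ i) (mem_univ _)
  rw [Matrix.submatrix_apply, hinv, bordered_succ, residueRow] at hi
  rw [Fin.rev_rev]
  by_contra h'
  exact hi (if_neg h')

theorem coeff_zero_truncF (d : ℕ) : (truncF d).coeff 0 = 1 := by
  simp [truncF, Polynomial.coeff_X_pow]

theorem isSchurExpansion_residueCoeff (d : ℕ) : IsSchurExpansion (truncF d) (residueCoeff d) :=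
  (satisfiesPieri_residueCoeff d).isSchurExpansion (coeff_zero_truncF d) (residueCoeff_bot d)

theorem isSchurExpansion_det_jacobiTrudi {F : Polynomial ℤ} (hF : F.coeff 0 = 1) :
    IsSchurExpansion F fun μ => (jacobiTrudi F μ).det :=
  (satisfiesPieri_det_jacobiTrudi hF).isSchurExpansion hF (det_jacobiTrudi_bot F)

end TruncatedSchur

theorem mainTheorem5 (d : ℕ) :
    ∃ s : YoungDiagram → ℤ,
      TruncatedSchur.IsSchurExpansion (TruncatedSchur.truncF d) s ∧
      (∀ s' : YoungDiagram → ℤ,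
        TruncatedSchur.IsSchurExpansion (TruncatedSchur.truncF d) s' → s' = s) ∧
      ∀ μ : YoungDiagram,
        s μ = (TruncatedSchur.jacobiTrudi (TruncatedSchur.truncF d) μ).det ∧
        (s μ = 1 ∨ s μ = -1 ∨ s μ = 0) ∧
        (∀ (r : Fin (d + 1)) (σ : Equiv.Perm (Fin d)), TruncatedSchur.Matches d μ r σ →
          s μ = (-1) ^ (μ.card + d + (r : ℕ)) * (Equiv.Perm.sign σ : ℤ)) ∧
        ((¬ ∃ (r : Fin (d + 1)) (σ : Equiv.Perm (Fin d)), TruncatedSchur.Matches d μ r σ) →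
          s μ = 0) := by
  have hs := TruncatedSchur.isSchurExpansion_residueCoeff d
  refine ⟨TruncatedSchur.residueCoeff d, hs, fun s' h => h.unique hs, fun μ => ⟨?_, ?_, ?_, ?_⟩⟩
  · exact congrFun (hs.unique (TruncatedSchur.isSchurExpansion_det_jacobiTrudi
      (TruncatedSchur.coeff_zero_truncF d))) μ
  · by_cases h0 : TruncatedSchur.residueCoeff d μ = 0
    · exact Or.inr (Or.inr h0)
    · obtain ⟨r, σ, h⟩ := TruncatedSchur.exists_matches_of_residueCoeff_ne_zero h0
      rw [TruncatedSchur.residueCoeff_of_matches h]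
      rcases neg_one_pow_eq_or ℤ (μ.card + d + (r : ℕ)) with h1 | h1 <;>
        rcases Int.units_eq_one_or (Equiv.Perm.sign σ) with h2 | h2 <;> simp [h1, h2]
  · exact fun r σ h => TruncatedSchur.residueCoeff_of_matches h
  · intro h
    by_contra h0
    exact h (TruncatedSchur.exists_matches_of_residueCoeff_ne_zero h0)
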